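/- Let $a,b,c,d\ge 0$ with $a+c=b+d>0$, and put $$p=\frac{a}{a+c},\quad r=\frac{b}{b+d},\quad \Delta=1-(p+r),\quad D=r-p,\quad P=(2p-1)(2r-1).$$ **The model.** The edges of the half-plane graph $\overline K_\infty$ are indexed by $(i,t)\in\mathbb Z\times\mathbb N$ ($\mathbb N\ni 0$), and an orientation of it is encoded by $e(i,t)\in\{0,1\}$, with $e(i,t)=1$ if the edge $(i,t)$ is up-oriented and $e(i,t)=0$ if it is down-oriented. The edges of lines $t$ and $t+1$ meet at vertices: the vertices between these lines join the pairs of edges $(i,t),(i+1,t)$ (below) and $(i,t+1),(i+1,t+1)$ (above), for all $i$ with $i+t$ even. The 8-vertex model on $\overline K_\infty$ with weights $a,b,c,d$, $a+c=b+d$, and free boundary conditions is the law $\overline P^8_\infty$ of the random orientation obtained as follows. The states $(e(i,0))_{i\in\mathbb Z}$ are i.i.d. Bernoulli with parameter $1/2$. The lines $(e(i,t))_{i\in\mathbb Z}$, $t\ge 0$, form a Markov chain; given line $t$, the pairs $(e(i,t+1),e(i+1,t+1))$, $i+t$ even, are independent, the law of each depends only on $(e(i,t),e(i+1,t))$, and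 for $k\in\{0,1\}$ $$(k,k)\mapsto\begin{cases}(k,k)&\text{with probability } r,\\(1-k,1-k)&\text{with probability }1-r,\end{cases}\qquad (k,1-k)\mapsto\begin{cases}(1-k,k)&\text{with probability } p,\\(k,1-k)&\text{with probability }1-p.\end{cases}$$ The edge correlation function is $$C_8(i,t)=\frac{\operatorname{Cov}(e(0,0),e(i,t))}{\sqrt{\operatorname{Var}(e(0,0))}\,\sqrt{\operatorname{Var}(e(i,t))}}\qquad\text{under } \overline P^8_\infty .$$ **Conventions.** $\binom nm=\frac{n(n-1)\cdots(n-m+1)}{m!}$ for integers $n$ and $m\ge 0$ (so $\binom{-1}{0}=1$), $\binom nm=0$ for $m<0$, and $\binom{n}{k,l,m}=\frac{n!}{k!\,l!\,m!}$ for $n=k+l+m$. Empty sums are $0$, $x^0=1$ for every real $x$, and a term whose binomial coefficient is $0$ is $0$. **Theorem.** All the variances $\operatorname{Var}(e(i,t))$ are positive, so that $C_8$ is well defined, and for all $i\in\mathbb Z$, $t\in\mathbb N$: * if $i+t$ is odd, $$C_8(i,t)=(-1)^{t+1}D\sum_{k=0}^{\frac{t-1-|i|}{2}}(-1)^k\binom{t-1-k}{k,\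 \frac{t-1+i}{2}-k,\ \frac{t-1-i}{2}-k}\Delta^{t-1-2k}P^k;$$ * if $t$ is even and $i=0$, $$C_8(0,t)=\sum_{k=0}^{t/2}(-1)^k\binom{t-1-k}{\frac t2-k}\binom{t/2}{k}\Delta^{t-2k}P^k;$$ * if $i+t$ is even and $i<0$, $$C_8(i,t)=\left(\sum_{k=0}^{\frac{t+i}{2}-1}(-1)^{t+k}\binom{t-1-k}{\frac{t-i}{2}-k}\binom{\frac{t+i}{2}}{k}\Delta^{t-2k}P^k\right)+(-1)^{\frac{t-i}{2}}\binom{\frac{t-i}{2}-1}{\frac{t+i}{2}-1}\Delta^{-i}P^{\frac{t+i}{2}};$$ * if $i+t$ is even and $i>0$, $$C_8(i,t)=\left(\sum_{k=0}^{\frac{t-i}{2}-1}(-1)^{t+k}\binom{t-1-k}{\frac{t-i}{2}-k}\binom{\frac{t+i}{2}}{k}\Delta^{t-2k}P^k\right)+(-1)^{\frac{t+i}{2}}\binom{\frac{t+i}{2}}{\frac{t-i}{2}}\Delta^{i}P^{\frac{t-i}{2}}.$$ -/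

import Mathlib

namespace EightVertex

open MeasureTheory ProbabilityTheory

/-- Orientations of the edges `(i, t)`, `t` fixed, of one line of the half-plane graph:
`true` is "up-oriented", `false` is "down-oriented". -/
abbrev Line : Type := ℤ → Bool

/-- Orientations of all the edges of the half-plane graph; `ω t i` is the orientation of the
edge `(i, t)`, with `i : ℤ` and `t : ℕ`. -/
abbrev Config : Type := ℕ → Line

/-- Law of the orientations of the two upper edges of a vertex whose two lower edges (left, right)
have orientations `u`, `v`. If `u = v`, both orientations are transmitted with probability `r` and
both are reversed with probability `1 - r`; if `u ≠ v`, both are reversed with probability `p` and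
both are transmitted with probability `1 - p`. (The number of incoming edges is always even.) -/
noncomputable def vertexLaw (p r : unitInterval) (u v : Bool) : Measure (Bool × Bool) :=
  if u = v then bernoulliMeasure (u, v) (!u, !v) r else bernoulliMeasure (!u, !v) (u, v) p

instance (p r : unitInterval) (u v : Bool) : IsProbabilityMeasure (vertexLaw p r u v) := by
  unfold vertexLaw; split_ifs <;> infer_instance

/-- Abscissa of the left edges of the `m`-th vertex between the lines `t` and `t + 1`: the edges
are paired as `(2m, 2m+1)` if `t` is even and as `(2m-1, 2m)` if `t` is odd. -/
def leftEdge (t : ℕ) (m : ℤ) : ℤ := 2 * m - (t % 2 : ℕ)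

/-- The line formed by a family of pairs: the `m`-th pair is placed at the abscissas
`leftEdge t m` and `leftEdge t m + 1`. -/
def ofPairs (t : ℕ) (y : ℤ → Bool × Bool) : Line := fun j =>
  let n : ℤ := j + (t % 2 : ℕ)
  if Even n then (y (n / 2)).1 else (y (n / 2)).2

theorem ofPairs_leftEdge (t : ℕ) (y : ℤ → Bool × Bool) (m : ℤ) :
    ofPairs t y (leftEdge t m) = (y m).1 ∧ ofPairs t y (leftEdge t m + 1) = (y m).2 := by
  have h2 : 2 * m - ((t % 2 : ℕ) : ℤ) + 1 + ((t % 2 : ℕ) : ℤ) = 2 * m + 1 := by ring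
  have h3 : ¬ Even (2 * m + 1) := by simp
  have h4 : (2 * m + 1) / 2 = m := by omega
  constructor
  · simp [ofPairs, leftEdge]
  · simp only [ofPairs, leftEdge, h2, h3, h4, if_false]

theorem measurable_ofPairs (t : ℕ) : Measurable (ofPairs t) := by
  refine measurable_pi_lambda _ fun j => ?_
  unfold ofPairs
  by_cases h : Even (j + ((t % 2 : ℕ) : ℤ))
  · simp only [h, if_true]; fun_prop
  · simp only [h, if_false]; fun_prop

theorem measurable_pairsLaw (p r : unitInterval) (t : ℕ) :
    Measurable fun x : Line => Measure.infinitePi fun m : ℤ =>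
      vertexLaw p r (x (leftEdge t m)) (x (leftEdge t m + 1)) := by
  refine Measurable.measure_of_isPiSystem_of_isProbabilityMeasure
    (S := squareCylinders fun _ : ℤ => {s : Set (Bool × Bool) | MeasurableSet s})
    generateFrom_squareCylinders.symm
    (isPiSystem_squareCylinders (fun _ => MeasurableSpace.isPiSystem_measurableSet)
      (by simp)) ?_
  rintro _ ⟨s, A, hA, rfl⟩
  have hA' : ∀ m, MeasurableSet (A m) := fun m => hA m (Set.mem_univ m)
  simp only [Measure.infinitePi_pi _ fun m _ => hA' m]
  refine Finset.measurable_prod _ fun m _ => ?_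
  have h : Measurable fun q : Bool × Bool => vertexLaw p r q.1 q.2 (A m) := measurable_of_finite _
  exact h.comp (f := fun x : Line => (x (leftEdge t m), x (leftEdge t m + 1))) (by fun_prop)

/-- Transition from line `t` to line `t + 1`: given line `t`, the pairs of orientations above the
vertices are independent, each with the law `vertexLaw` given by the pair below it. -/
noncomputable def lineKernel (p r : unitInterval) (t : ℕ) : Kernel Line Line :=
  Kernel.map
    { toFun := fun x => Measure.infinitePi fun m : ℤ =>
        vertexLaw p r (x (leftEdge t m)) (x (leftEdge t m + 1))
      measurable' := measurable_pairsLaw p r t }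
    (ofPairs t)

theorem lineKernel_apply (p r : unitInterval) (t : ℕ) (x : Line) :
    lineKernel p r t x = (Measure.infinitePi fun m : ℤ =>
      vertexLaw p r (x (leftEdge t m)) (x (leftEdge t m + 1))).map (ofPairs t) :=
  Kernel.map_apply _ (measurable_ofPairs t) x

instance (p r : unitInterval) (t : ℕ) : IsMarkovKernel (lineKernel p r t) where
  isProbabilityMeasure x := by
    rw [lineKernel_apply]
    exact Measure.isProbabilityMeasure_map (measurable_ofPairs t).aemeasurable

/-- The line `t`, as a function of the lines `0, …, t`. -/
def lastLine (t : ℕ) (h : (n : Finset.Iic t) → Line) : Line := h ⟨t, Finset.mem_Iic.2 le_rfl⟩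

theorem measurable_lastLine (t : ℕ) : Measurable (lastLine t) := measurable_pi_apply _

/-- The law `𝓛(μ; p, r)` of the orientations of all the edges: line `0` has law `μ`, and the lines
form an (inhomogeneous) Markov chain with transitions `lineKernel p r t`. -/
noncomputable def chainLaw (μ : Measure Line) (p r : unitInterval) : Measure Config :=
  Kernel.trajMeasure (X := fun _ : ℕ => Line) μ
    fun t => (lineKernel p r t).comap (lastLine t) (measurable_lastLine t)

/-- The product measure of parameter `q` on the orientations of a line. -/
noncomputable def productLaw (q : unitInterval) : Measure Line :=
  Measure.infinitePi fun _ : ℤ => bernoulliMeasure true false q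

/-- `x / (x + y)`, as an element of `[0, 1]`. -/
noncomputable def ratio (x y : NNReal) : unitInterval :=
  ⟨(x : ℝ) / (x + y), by positivity, div_le_one_of_le₀ (by simp) (by positivity)⟩

/-- The law of the 8-vertex model with weights `a, b, c, d`, `a + c = b + d`, on the half-plane
graph with free boundary conditions: `𝓛(μ; a / (a + c), b / (b + d))` with `μ` the product measure
of parameter `1 / 2`. -/
noncomputable def eightVertexLaw (a b c d : NNReal) : Measure Config :=
  chainLaw (productLaw ⟨1 / 2, by norm_num, by norm_num⟩) (ratio a c) (ratio b d)

/-- The state `e(i, t)`: `1` if the edge `(i, t)` is up-oriented and `0` if it is down-oriented. -/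
def state (i : ℤ) (t : ℕ) (ω : Config) : ℝ := if ω t i then 1 else 0

/-- The edge correlation function `C((i, t); (i', t'))`, under the law `ν`. -/
noncomputable def edgeCorrelation (ν : Measure Config) (i : ℤ) (t : ℕ) (i' : ℤ) (t' : ℕ) : ℝ :=
  covariance (state i t) (state i' t') ν /
    (Real.sqrt (variance (state i t) ν) * Real.sqrt (variance (state i' t') ν))

/-- The binomial coefficient `n (n - 1) ⋯ (n - m + 1) / m!`, and `0` if `m < 0`. -/
noncomputable def binom (n m : ℤ) : ℝ := if 0 ≤ m then ((Ring.choose n m.toNat : ℤ) : ℝ) else 0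

/-- The multinomial coefficient `n! / (k! l! m!)`, for `n = k + l + m` and `k, l, m ≥ 0`. -/
noncomputable def trinom (n k l m : ℤ) : ℝ :=
  (n.toNat.factorial : ℝ) / (k.toNat.factorial * l.toNat.factorial * m.toNat.factorial)

end EightVertex

open EightVertex

namespace EightVertex

open MeasureTheory ProbabilityTheory

/-! In spins `±1`, the conditional mean of an edge given the line below is linear in the two edges
under its vertex: `D` times the edge straight below minus `Δ` times its partner. Since line `0` is
symmetric, all spins are centred, every state has variance `1/4`, and `C₈` is the spin correlation
`spinCorr`. By the Markov property this obeys a linear recursion in `t`, started from a unit mass at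
`0`; whether the partner is `i + 1` or `i - 1` depends on the parity of `i + t`.

Let `q(u, v)` be the coefficient of `x ^ u * y ^ v` in `1 / (1 - Δ x - Δ y + P x y)`, and write `i =
u - v`. Because `P = Δ ^ 2 - D ^ 2`, the recursion is solved by `(-1) ^ (t + 1) * D * q(u, v)` on `u
+ v = t - 1`, and by `(-1) ^ t * (q(u, v) - Δ * q(u, v - 1))` on `u + v = t` (`spinCorr_eq`).

Expanding `q` in trinomial coefficients gives the odd case. In the even case the difference merges
term by term into products of two binomials (`octant_sub`), and the three stated formulas are this
one sum with its last term rewritten. -/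

/-! ### Mean spins after one transition -/

/-- The spin `±1` of an orientation. -/
def spin (u : Bool) : ℝ := if u then 1 else -1

theorem measurable_spin : Measurable spin := measurable_of_finite _

theorem abs_spin (u : Bool) : |spin u| = 1 := by cases u <;> simp [spin]

/-- The mean of the upper left spin is `2 r - 1` times the lower left one if the lower spins agree,
and `1 - 2 p` times it otherwise. Coefficients `α, β` with `α + β = 2 r - 1` and `α - β = 1 - 2 p`
fit both cases, whence `α = r - p` and `β = p + r - 1`. -/
theorem integral_vertexLaw (p r : unitInterval) (u v : Bool) :
    ∫ z, spin z.1 ∂vertexLaw p r u v = ((r : ℝ) - p) * spin u - (1 - (p + r)) * spin v ∧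
    ∫ z, spin z.2 ∂vertexLaw p r u v = ((r : ℝ) - p) * spin v - (1 - (p + r)) * spin u := by
  cases u <;> cases v <;> simp [vertexLaw, integral_bernoulliMeasure, spin] <;> ring_nf <;> simp

/-- The mean spins above a vertex are linear in the spins below it. -/
theorem integral_lineKernel_left (p r : unitInterval) (t : ℕ) (x : Line) (i : ℤ)
    (hi : Even (i + t)) :
    ∫ y, spin (y i) ∂lineKernel p r t x =
      ((r : ℝ) - p) * spin (x i) - (1 - (p + r)) * spin (x (i + 1)) := by
  -- When `i + t` is even, `i` is the left edge of its pair.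
  obtain ⟨m, rfl⟩ : ∃ m, i = leftEdge t m := by
    obtain ⟨n, hn⟩ := hi
    exact ⟨(i + (t % 2 : ℕ)) / 2, by unfold leftEdge; omega⟩
  have hs : Measurable fun z : Bool × Bool => spin z.1 := measurable_of_finite _
  have hy (ν : Measure Line) (j : ℤ) : AEStronglyMeasurable (fun y => spin (y j)) ν :=
    (measurable_spin.comp (measurable_pi_apply j)).aestronglyMeasurable
  rw [lineKernel_apply, integral_map (measurable_ofPairs t).aemeasurable
    (f := fun y : Line => spin (y _)) (hy _ _)]
  simp only [(ofPairs_leftEdge t _ m).1]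
  rw [← (integral_vertexLaw p r _ _).1, ← Measure.infinitePi_map_eval
    (fun m : ℤ => vertexLaw p r (x (leftEdge t m)) (x (leftEdge t m + 1))) m, integral_map
    (measurable_pi_apply m).aemeasurable hs.aestronglyMeasurable]

theorem integral_lineKernel_right (p r : unitInterval) (t : ℕ) (x : Line) (i : ℤ)
    (hi : Odd (i + t)) :
    ∫ y, spin (y i) ∂lineKernel p r t x =
      ((r : ℝ) - p) * spin (x i) - (1 - (p + r)) * spin (x (i - 1)) := by
  obtain ⟨m, rfl⟩ : ∃ m, i = leftEdge t m + 1 := by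
    obtain ⟨n, hn⟩ := hi
    exact ⟨(i + (t % 2 : ℕ)) / 2, by unfold leftEdge; omega⟩
  have hs : Measurable fun z : Bool × Bool => spin z.2 := measurable_of_finite _
  have hy (ν : Measure Line) (j : ℤ) : AEStronglyMeasurable (fun y => spin (y j)) ν :=
    (measurable_spin.comp (measurable_pi_apply j)).aestronglyMeasurable
  rw [lineKernel_apply, integral_map (measurable_ofPairs t).aemeasurable
    (f := fun y : Line => spin (y _)) (hy _ _)]
  simp only [(ofPairs_leftEdge t _ m).2, add_sub_cancel_right]
  rw [← (integral_vertexLaw p r _ _).2, ← Measure.infinitePi_map_eval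
    (fun m : ℤ => vertexLaw p r (x (leftEdge t m)) (x (leftEdge t m + 1))) m, integral_map
    (measurable_pi_apply m).aemeasurable hs.aestronglyMeasurable]

/-! ### The Markov chain of lines -/

instance (q : unitInterval) : IsProbabilityMeasure (productLaw q) := by
  unfold productLaw; infer_instance

instance (μ : Measure Line) [IsProbabilityMeasure μ] (p r : unitInterval) :
    IsProbabilityMeasure (chainLaw μ p r) := by
  unfold chainLaw; infer_instance

theorem measurable_spin_apply (t : ℕ) (i : ℤ) : Measurable fun ω : Config => spin (ω t i) :=
  measurable_spin.comp ((measurable_pi_apply i).comp (measurable_pi_apply t))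

/-- Markov property of the chain of lines. -/
theorem integral_chainLaw_succ (μ : Measure Line) [IsProbabilityMeasure μ] (p r : unitInterval)
    (t : ℕ) (i : ℤ) (f : Line → ℝ) (hf : Measurable f) (hb : ∀ x, |f x| ≤ 1) :
    ∫ ω, f (ω 0) * spin (ω (t + 1) i) ∂chainLaw μ p r =
      ∫ ω, f (ω 0) * ∫ y, spin (y i) ∂lineKernel p r t (ω t) ∂chainLaw μ p r := by
  -- The joint law of the lines up to `t` and of line `t + 1` is a composition product. Line `0` is
  -- among the former, so `f` leaves the inner integral.
  have key := Kernel.map_frestrictLe_trajMeasure_compProd_eq_map_trajMeasure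
    (X := fun _ : ℕ => Line) (μ₀ := μ)
    (κ := fun t => (lineKernel p r t).comap (lastLine t) (measurable_lastLine t)) (a := t)
  let z : Finset.Iic t := ⟨0, Finset.mem_Iic.2 t.zero_le⟩
  let g : ((n : Finset.Iic t) → Line) × Line → ℝ := fun w => f (w.1 z) * spin (w.2 i)
  have hg : Measurable g :=
    (hf.comp ((measurable_pi_apply z).comp measurable_fst)).mul
      (measurable_spin.comp ((measurable_pi_apply i).comp measurable_snd))
  have h1 : ∫ ω, f (ω 0) * spin (ω (t + 1) i) ∂chainLaw μ p r =
      ∫ w, g w ∂((chainLaw μ p r).map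
        (fun x => (Preorder.frestrictLe t x, x (t + 1)))) := by
    rw [integral_map (by fun_prop) hg.aestronglyMeasurable]
    rfl
  have hmp : IsProbabilityMeasure ((chainLaw μ p r).map (Preorder.frestrictLe t)) :=
    Measure.isProbabilityMeasure_map (by fun_prop)
  rw [h1, chainLaw, ← key, Measure.integral_compProd]
  · have hm : AEStronglyMeasurable (fun x : (n : Finset.Iic t) → Line =>
        ∫ y, g (x, y) ∂((lineKernel p r t).comap (lastLine t) (measurable_lastLine t) x))
        ((chainLaw μ p r).map (Preorder.frestrictLe t)) :=
      hg.stronglyMeasurable.integral_kernel_prod_right'.aestronglyMeasurable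
    refine (integral_map (φ := Preorder.frestrictLe t)
      (Preorder.measurable_frestrictLe t).aemeasurable hm).trans ?_
    refine integral_congr_ae (Filter.Eventually.of_forall fun ω => ?_)
    simp only [g, integral_const_mul]
    rfl
  · refine Integrable.of_bound hg.aestronglyMeasurable 1 (Filter.Eventually.of_forall fun w => ?_)
    simp only [g, Real.norm_eq_abs, abs_mul, abs_spin, mul_one]
    exact hb _

theorem map_chainLaw_zero (μ : Measure Line) [IsProbabilityMeasure μ] (p r : unitInterval) :
    (chainLaw μ p r).map (fun ω => ω 0) = μ := by
  have h : (fun ω : Config => ω 0) = lastLine 0 ∘ Preorder.frestrictLe (π := fun _ => Line) 0 :=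
    rfl
  rw [h, ← Measure.map_map (measurable_lastLine 0) (by fun_prop), chainLaw, Kernel.trajMeasure,
    Measure.map_comp _ _ (by fun_prop), Kernel.traj_map_frestrictLe, Kernel.partialTraj_self,
    Measure.id_comp, Measure.map_map (measurable_lastLine 0) (by fun_prop)]
  exact Measure.map_id

theorem integrable_mul_spin (μ : Measure Line) [IsProbabilityMeasure μ] (p r : unitInterval)
    (t : ℕ) (i : ℤ) (f : Line → ℝ) (hf : Measurable f) (hb : ∀ x, |f x| ≤ 1) :
    Integrable (fun ω => f (ω 0) * spin (ω t i)) (chainLaw μ p r) := by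
  refine Integrable.of_bound ((hf.comp (measurable_pi_apply 0)).mul
    (measurable_spin_apply t i)).aestronglyMeasurable 1 (Filter.Eventually.of_forall fun w => ?_)
  simp only [Real.norm_eq_abs, abs_mul, abs_spin, mul_one]
  exact hb _

/-- The weight `f` serves twice: `f = 1` gives the means, and the spin of `(0, 0)` gives the
correlations. -/
theorem integral_spin_succ_left (μ : Measure Line) [IsProbabilityMeasure μ] (p r : unitInterval)
    (t : ℕ) (i : ℤ) (hi : Even (i + t)) (f : Line → ℝ) (hf : Measurable f)
    (hb : ∀ x, |f x| ≤ 1) :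
    ∫ ω, f (ω 0) * spin (ω (t + 1) i) ∂chainLaw μ p r =
      ((r : ℝ) - p) * ∫ ω, f (ω 0) * spin (ω t i) ∂chainLaw μ p r
        - (1 - (p + r)) * ∫ ω, f (ω 0) * spin (ω t (i + 1)) ∂chainLaw μ p r := by
  rw [integral_chainLaw_succ μ p r t i f hf hb, ← integral_const_mul, ← integral_const_mul,
    ← integral_sub ((integrable_mul_spin μ p r t i f hf hb).const_mul _)
      ((integrable_mul_spin μ p r t (i + 1) f hf hb).const_mul _)]
  congr 1 with ω
  rw [integral_lineKernel_left p r t _ i hi]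
  ring

theorem integral_spin_succ_right (μ : Measure Line) [IsProbabilityMeasure μ] (p r : unitInterval)
    (t : ℕ) (i : ℤ) (hi : Odd (i + t)) (f : Line → ℝ) (hf : Measurable f)
    (hb : ∀ x, |f x| ≤ 1) :
    ∫ ω, f (ω 0) * spin (ω (t + 1) i) ∂chainLaw μ p r =
      ((r : ℝ) - p) * ∫ ω, f (ω 0) * spin (ω t i) ∂chainLaw μ p r
        - (1 - (p + r)) * ∫ ω, f (ω 0) * spin (ω t (i - 1)) ∂chainLaw μ p r := by
  rw [integral_chainLaw_succ μ p r t i f hf hb, ← integral_const_mul, ← integral_const_mul,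
    ← integral_sub ((integrable_mul_spin μ p r t i f hf hb).const_mul _)
      ((integrable_mul_spin μ p r t (i - 1) f hf hb).const_mul _)]
  congr 1 with ω
  rw [integral_lineKernel_right p r t _ i hi]
  ring

/-! ### Symmetric initial line and recursion for the spin correlation -/

/-- The parameter `1 / 2`. -/
noncomputable def half : unitInterval := ⟨1 / 2, by norm_num, by norm_num⟩

theorem integral_productLaw_spin (i : ℤ) : ∫ x, spin (x i) ∂productLaw half = 0 := by
  have h := measurePreserving_eval_infinitePi
    (fun _ : ℤ => bernoulliMeasure true false half) i
  have h2 := integral_map (μ := productLaw half) (φ := fun x : Line => x i) (f := spin)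
    (measurable_pi_apply i).aemeasurable measurable_spin.aestronglyMeasurable
  rw [← h2]
  have h3 : (productLaw half).map (fun x : Line => x i) = bernoulliMeasure true false half :=
    h.map_eq
  rw [h3, integral_bernoulliMeasure]
  norm_num [half, spin]

theorem integral_productLaw_spin_mul_spin (i : ℤ) :
    ∫ x, spin (x 0) * spin (x i) ∂productLaw half = if i = 0 then 1 else 0 := by
  split_ifs with hi
  · subst hi
    have : ∀ x : Line, spin (x 0) * spin (x 0) = 1 := fun x => by cases x 0 <;> simp [spin]
    simp [this]
  · have hind := (iIndepFun_infinitePi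
      (P := fun _ : ℤ => bernoulliMeasure true false half)
      (X := fun _ : ℤ => spin) (fun _ => measurable_spin)).indepFun (Ne.symm hi)
    have := hind.integral_fun_mul_eq_mul_integral
      (measurable_spin.comp (measurable_pi_apply 0)).aestronglyMeasurable
      (measurable_spin.comp (measurable_pi_apply i)).aestronglyMeasurable
    refine this.trans ?_
    have h := integral_productLaw_spin i
    unfold productLaw at h
    rw [h, mul_zero]

theorem integral_chainLaw_spin (p r : unitInterval) (t : ℕ) (i : ℤ) :
    ∫ ω, spin (ω t i) ∂chainLaw (productLaw half) p r = 0 := by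
  induction t generalizing i with
  | zero =>
    have h := integral_map (μ := chainLaw (productLaw half) p r) (φ := fun ω : Config => ω 0)
      (f := fun x => spin (x i)) (measurable_pi_apply 0).aemeasurable
      (measurable_spin.comp (measurable_pi_apply i)).aestronglyMeasurable
    rw [← h, map_chainLaw_zero, integral_productLaw_spin]
  | succ t ih =>
    rcases Int.even_or_odd (i + t) with hi | hi
    · have := integral_spin_succ_left (productLaw half) p r t i hi (fun _ => 1) measurable_const
        (by simp)
      simpa [ih] using this
    · have := integral_spin_succ_right (productLaw half) p r t i hi (fun _ => 1) measurable_const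
        (by simp)
      simpa [ih] using this

/-- The correlation of the spins of the edges `(0, 0)` and `(i, t)`. -/
noncomputable def spinCorr (p r : unitInterval) (t : ℕ) (i : ℤ) : ℝ :=
  ∫ ω, spin (ω 0 0) * spin (ω t i) ∂chainLaw (productLaw half) p r

theorem spinCorr_zero (p r : unitInterval) (i : ℤ) :
    spinCorr p r 0 i = if i = 0 then 1 else 0 := by
  have h := integral_map (μ := chainLaw (productLaw half) p r) (φ := fun ω : Config => ω 0)
    (f := fun x => spin (x 0) * spin (x i)) (measurable_pi_apply 0).aemeasurable
    ((measurable_spin.comp (measurable_pi_apply 0)).mul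
      (measurable_spin.comp (measurable_pi_apply i))).aestronglyMeasurable
  rw [spinCorr, ← h, map_chainLaw_zero, integral_productLaw_spin_mul_spin]

theorem spinCorr_succ_left (p r : unitInterval) (t : ℕ) (i : ℤ) (hi : Even (i + t)) :
    spinCorr p r (t + 1) i =
      ((r : ℝ) - p) * spinCorr p r t i - (1 - (p + r)) * spinCorr p r t (i + 1) :=
  integral_spin_succ_left _ p r t i hi (fun x => spin (x 0))
    (measurable_spin.comp (measurable_pi_apply 0)) fun _ => (abs_spin _).le

theorem spinCorr_succ_right (p r : unitInterval) (t : ℕ) (i : ℤ) (hi : Odd (i + t)) :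
    spinCorr p r (t + 1) i =
      ((r : ℝ) - p) * spinCorr p r t i - (1 - (p + r)) * spinCorr p r t (i - 1) :=
  integral_spin_succ_right _ p r t i hi (fun x => spin (x 0))
    (measurable_spin.comp (measurable_pi_apply 0)) fun _ => (abs_spin _).le

/-! ### From states to spins -/

theorem state_eq (i : ℤ) (t : ℕ) : state i t = fun ω => 2⁻¹ + 2⁻¹ * spin (ω t i) := by
  funext ω
  unfold state spin
  split_ifs <;> norm_num

theorem memLp_spin (ν : Measure Config) [IsProbabilityMeasure ν] (t : ℕ) (i : ℤ) :
    MemLp (fun ω : Config => spin (ω t i)) 2 ν :=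
  MemLp.of_bound (measurable_spin_apply t i).aestronglyMeasurable 1
    (Filter.Eventually.of_forall fun _ => (abs_spin _).le)

theorem covariance_state (ν : Measure Config) [IsProbabilityMeasure ν]
    (h0 : ∀ t i, ∫ ω, spin (ω t i) ∂ν = 0) (i : ℤ) (t : ℕ) (i' : ℤ) (t' : ℕ) :
    covariance (state i t) (state i' t') ν = 4⁻¹ * ∫ ω, spin (ω t i) * spin (ω t' i') ∂ν := by
  rw [state_eq, state_eq, covariance_const_add_left, covariance_const_add_right,
    covariance_const_mul_left, covariance_const_mul_right,
    covariance_eq_sub (memLp_spin ν t i) (memLp_spin ν t' i'), h0, h0]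
  · simp only [Pi.mul_apply]; ring
  · exact ((memLp_spin ν t' i').integrable (by norm_num)).const_mul _
  · exact ((memLp_spin ν t i).integrable (by norm_num)).const_mul _

theorem variance_state (ν : Measure Config) [IsProbabilityMeasure ν]
    (h0 : ∀ t i, ∫ ω, spin (ω t i) ∂ν = 0) (i : ℤ) (t : ℕ) :
    variance (state i t) ν = 4⁻¹ := by
  have hm : AEMeasurable (state i t) ν := by
    rw [state_eq]
    exact (((measurable_spin_apply t i).const_mul _).const_add _).aemeasurable
  have : ∀ ω : Config, spin (ω t i) * spin (ω t i) = 1 := fun ω => by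
    cases ω t i <;> simp [spin]
  rw [← covariance_self hm, covariance_state ν h0]
  simp [this]

theorem edgeCorrelation_eq_spinCorr (p r : unitInterval) (i : ℤ) (t : ℕ) :
    edgeCorrelation (chainLaw (productLaw half) p r) 0 0 i t = spinCorr p r t i := by
  have h0 := integral_chainLaw_spin p r
  rw [edgeCorrelation, covariance_state _ h0, variance_state _ h0, variance_state _ h0,
    Real.mul_self_sqrt (by norm_num), spinCorr]
  field_simp

/-! ### Coefficients of the generating function -/

/-- The monomial of multidegree `(k, l, m)` of the generating function
`1 / (1 - Δ x - Δ y + P x y)`, and `0` outside the positive octant. -/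
noncomputable def octant (Δ P : ℝ) (k l m : ℤ) : ℝ :=
  if 0 ≤ k ∧ 0 ≤ l ∧ 0 ≤ m then trinom (k + l + m) k l m * Δ ^ (l + m) * (-P) ^ k else 0

theorem octant_natCast (Δ P : ℝ) (k l m : ℕ) :
    octant Δ P k l m = ((k + l + m).factorial : ℝ) / (k.factorial * l.factorial * m.factorial)
      * Δ ^ (l + m) * (-P) ^ k := by
  have h : ((k : ℤ) + l + m).toNat = k + l + m := by omega
  have h2 : (l : ℤ) + m = ((l + m : ℕ) : ℤ) := by push_cast; ring
  simp only [octant, trinom, h, Int.toNat_natCast, h2, zpow_natCast]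
  simp

theorem octant_of_neg (Δ P : ℝ) {k l m : ℤ} (h : k < 0 ∨ l < 0 ∨ m < 0) :
    octant Δ P k l m = 0 := by
  unfold octant
  rw [if_neg]
  omega

/-- Absorption identity for trinomial coefficients. The zero extension of `octant` makes it valid on
the boundary `k = 0` and for all integers. -/
theorem mul_octant_first (Δ P : ℝ) (k l m : ℤ) :
    ((k + l + m : ℤ) : ℝ) * (-P * octant Δ P (k - 1) l m) = k * octant Δ P k l m := by
  by_cases h : k < 0 ∨ l < 0 ∨ m < 0
  · rw [octant_of_neg Δ P h, octant_of_neg Δ P (by omega)]; simp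
  push Not at h
  lift k to ℕ using h.1
  lift l to ℕ using h.2.1
  lift m to ℕ using h.2.2
  rcases k with _ | k
  · rw [octant_of_neg Δ P (by simp)]; simp
  · have e : ((k + 1 : ℕ) : ℤ) - 1 = k := by push_cast; ring
    rw [e, octant_natCast, octant_natCast, show k + 1 + l + m = (k + l + m) + 1 by ring,
      Nat.factorial_succ, Nat.factorial_succ]
    push_cast
    have := k.factorial_ne_zero; have := l.factorial_ne_zero; have := m.factorial_ne_zero
    field_simp
    ring

theorem mul_octant_second (Δ P : ℝ) (k l m : ℤ) :
    ((k + l + m : ℤ) : ℝ) * (Δ * octant Δ P k (l - 1) m) = l * octant Δ P k l m := by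
  by_cases h : k < 0 ∨ l < 0 ∨ m < 0
  · rw [octant_of_neg Δ P h, octant_of_neg Δ P (by omega)]; simp
  push Not at h
  lift k to ℕ using h.1
  lift l to ℕ using h.2.1
  lift m to ℕ using h.2.2
  rcases l with _ | l
  · rw [octant_of_neg Δ P (l := _ - 1) (by simp)]; simp
  · have e : ((l + 1 : ℕ) : ℤ) - 1 = l := by push_cast; ring
    rw [e, octant_natCast, octant_natCast, show k + (l + 1) + m = (k + l + m) + 1 by ring,
      Nat.factorial_succ, Nat.factorial_succ]
    push_cast
    have := k.factorial_ne_zero; have := l.factorial_ne_zero; have := m.factorial_ne_zero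
    field_simp
    ring

theorem octant_swap (Δ P : ℝ) (k l m : ℤ) : octant Δ P k l m = octant Δ P k m l := by
  unfold octant trinom
  rw [show k + l + m = k + m + l by ring, add_comm l m, mul_right_comm (k.toNat.factorial : ℝ)]
  simp only [and_comm (a := 0 ≤ l)]

theorem mul_octant_third (Δ P : ℝ) (k l m : ℤ) :
    ((k + l + m : ℤ) : ℝ) * (Δ * octant Δ P k l (m - 1)) = m * octant Δ P k l m := by
  rw [octant_swap, octant_swap Δ P k l m, ← mul_octant_second, add_right_comm]

/-- Pascal's rule: add the three absorption identities and divide by the total degree, nonzero away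
from the origin. -/
theorem octant_rec (Δ P : ℝ) (k l m : ℤ) (h : ¬ (k = 0 ∧ l = 0 ∧ m = 0)) :
    octant Δ P k l m =
      -P * octant Δ P (k - 1) l m + Δ * octant Δ P k (l - 1) m + Δ * octant Δ P k l (m - 1) := by
  by_cases hn : k < 0 ∨ l < 0 ∨ m < 0
  · rw [octant_of_neg Δ P hn, octant_of_neg Δ P (by omega), octant_of_neg Δ P (by omega),
      octant_of_neg Δ P (by omega)]
    simp
  have h0 : ((k + l + m : ℤ) : ℝ) ≠ 0 := by
    rw [Int.cast_ne_zero]; omega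
  refine mul_left_cancel₀ h0 ?_
  rw [mul_add, mul_add, mul_octant_first, mul_octant_second, mul_octant_third]
  push_cast
  ring

/-- The coefficient of `x ^ u * y ^ v` in `1 / (1 - Δ x - Δ y + P x y)`. -/
noncomputable def quadrant (Δ P : ℝ) (u v : ℤ) : ℝ :=
  ∑ k ∈ Finset.Icc 0 u, octant Δ P k (u - k) (v - k)

/-- Terms with `k > min u v` vanish, so sums for neighbouring `(u, v)` can share one range. -/
theorem quadrant_eq_sum (Δ P : ℝ) (u v N : ℤ) (hN : min u v ≤ N) :
    quadrant Δ P u v = ∑ k ∈ Finset.Icc 0 N, octant Δ P k (u - k) (v - k) := by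
  have key : ∀ M, min u v ≤ M → ∑ k ∈ Finset.Icc 0 M, octant Δ P k (u - k) (v - k) =
      ∑ k ∈ Finset.Icc 0 (min u v), octant Δ P k (u - k) (v - k) := by
    intro M hM
    refine (Finset.sum_subset (Finset.Icc_subset_Icc le_rfl hM) fun k hk hk' => ?_).symm
    rw [Finset.mem_Icc] at hk hk'
    exact octant_of_neg Δ P (by omega)
  rw [quadrant, key u (min_le_left _ _), key N hN]

theorem quadrant_of_neg (Δ P : ℝ) {u v : ℤ} (h : u < 0 ∨ v < 0) : quadrant Δ P u v = 0 := by
  rw [quadrant_eq_sum Δ P u v (-1) (by omega)]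
  simp

theorem quadrant_zero (Δ P : ℝ) : quadrant Δ P 0 0 = 1 := by
  simp [quadrant, octant, trinom]

theorem quadrant_rec (Δ P : ℝ) (u v : ℤ) (h : ¬ (u = 0 ∧ v = 0)) :
    quadrant Δ P u v = Δ * quadrant Δ P (u - 1) v + Δ * quadrant Δ P u (v - 1)
      - P * quadrant Δ P (u - 1) (v - 1) := by
  have hs : quadrant Δ P (u - 1) (v - 1) =
      ∑ k ∈ Finset.Icc 0 u, octant Δ P (k - 1) (u - k) (v - k) := by
    have h1 : ∑ k ∈ Finset.Icc 0 u, octant Δ P (k - 1) (u - k) (v - k) =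
        ∑ k ∈ Finset.Icc 1 u, octant Δ P (k - 1) (u - k) (v - k) := by
      refine (Finset.sum_subset (Finset.Icc_subset_Icc zero_le_one le_rfl) fun k hk hk' => ?_).symm
      rw [Finset.mem_Icc] at hk hk'
      exact octant_of_neg Δ P (by omega)
    rw [h1, quadrant]
    refine Finset.sum_nbij' (· + 1) (· - 1) ?_ ?_ ?_ ?_ ?_
    · intro k; simp only [Finset.mem_Icc]; omega
    · intro k; simp only [Finset.mem_Icc]; omega
    · intro k; simp
    · intro k; simp
    · intro k _
      congr 1 <;> ring
  rw [hs, quadrant_eq_sum Δ P (u - 1) v u (by omega), quadrant_eq_sum Δ P u (v - 1) u (by omega),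
    quadrant, Finset.mul_sum, Finset.mul_sum, Finset.mul_sum, ← Finset.sum_add_distrib,
    ← Finset.sum_sub_distrib]
  refine Finset.sum_congr rfl fun k _ => ?_
  rw [octant_rec Δ P k (u - k) (v - k) (by omega), sub_right_comm u k 1, sub_right_comm v k 1]
  ring

/-! ### Solution of the recursion -/

/-- Closed form of the spin correlation. -/
theorem spinCorr_eq (p r : unitInterval) (Δ D P : ℝ) (hΔ : Δ = 1 - (p + r)) (hD : D = r - p)
    (hP : P = (2 * p - 1) * (2 * r - 1)) (t : ℕ) :
    (∀ u v : ℤ, u + v + 1 = t → spinCorr p r t (u - v) = (-1) ^ (t + 1) * D * quadrant Δ P u v) ∧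
    (∀ u v : ℤ, u + v = t → spinCorr p r t (u - v) =
      (-1) ^ t * (quadrant Δ P u v - Δ * quadrant Δ P u (v - 1))) := by
  -- This identity matches the recursion on spins with that of `quadrant`.
  have hPD : P = Δ ^ 2 - D ^ 2 := by rw [hΔ, hD, hP]; ring
  induction t with
  | zero =>
    constructor
    · intro u v h
      push_cast at h
      rw [spinCorr_zero, if_neg (by omega), quadrant_of_neg Δ P (by omega)]
      simp
    · intro u v h
      push_cast at h
      rw [spinCorr_zero, quadrant_of_neg Δ P (v := v - 1) (by omega)]
      split_ifs with h0
      · obtain ⟨rfl, rfl⟩ : u = 0 ∧ v = 0 := by omega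
        simp [quadrant_zero]
      · rw [quadrant_of_neg Δ P (by omega)]; simp
  | succ t ih =>
    constructor
    · intro u v h
      push_cast at h
      -- The two contributions `Δ * D * quadrant Δ P u (v - 1)` cancel.
      have h1 := ih.2 u v (by omega)
      have h2 := ih.1 u (v - 1) (by omega)
      rw [spinCorr_succ_left p r t _ ⟨u, by omega⟩, ← hΔ, ← hD,
        show u - v + 1 = u - (v - 1) by ring, h1, h2]
      ring
    · intro u v h
      push_cast at h
      -- The coefficient of `quadrant Δ P (u - 1) (v - 1)` is `D ^ 2 - Δ ^ 2 = -P` up to sign, so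
      -- `quadrant_rec` at `(u, v)` applies.
      have h1 := ih.1 (u - 1) (v - 1) (by omega)
      have h2 := ih.2 (u - 1) v (by omega)
      rw [spinCorr_succ_right p r t _ ⟨u - 1, by omega⟩, ← hΔ, ← hD,
        show u - v = u - 1 - (v - 1) by ring, h1,
        show u - 1 - (v - 1) - 1 = u - 1 - v by ring, h2, quadrant_rec Δ P u v (by omega), hPD]
      ring

/-! ### Reduction to binomial coefficients -/

theorem binom_natCast (n m : ℕ) : binom n m = (n.choose m : ℝ) := by
  simp [binom, Ring.choose_natCast]

theorem binom_zero_right (n : ℤ) : binom n 0 = 1 := by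
  simp [binom]

theorem binom_self (n : ℤ) (hn : 0 ≤ n) : binom n n = 1 := by
  lift n to ℕ using hn
  simp [binom_natCast]

theorem binom_of_neg (n m : ℤ) (h : m < 0) : binom n m = 0 := by
  simp [binom, h.not_ge]

theorem binom_of_lt (n m : ℤ) (hn : 0 ≤ n) (h : n < m) : binom n m = 0 := by
  lift n to ℕ using hn
  lift m to ℕ using (by omega)
  rw [binom_natCast, Nat.choose_eq_zero_of_lt (by omega), Nat.cast_zero]

theorem binom_symm (n m : ℤ) (hn : 0 ≤ n) : binom n (n - m) = binom n m := by
  rcases lt_or_ge m 0 with hm | hm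
  · rw [binom_of_neg n m hm, binom_of_lt n _ hn (by omega)]
  rcases lt_or_ge n m with h | h
  · rw [binom_of_lt n m hn h, binom_of_neg n _ (by omega)]
  lift n to ℕ using hn
  lift m to ℕ using hm
  rw [← Nat.cast_sub (by omega), binom_natCast, binom_natCast, Nat.choose_symm (by omega)]

/-- With `n = k + l + m`, absorption turns the left side into `(1 - m / n)` times a trinomial term,
and `(k + l) / n` times the trinomial coefficient is the product of the two binomials. -/
theorem octant_sub (Δ P : ℝ) (k l m : ℤ) (hk : 0 ≤ k) (hl : 0 ≤ l) (hm : 0 ≤ m) :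
    octant Δ P k l m - Δ * octant Δ P k l (m - 1) =
      (-1) ^ k * binom (k + l + m - 1) m * binom (k + l) k * Δ ^ (l + m) * P ^ k := by
  by_cases h0 : k + l = 0
  · obtain ⟨rfl, rfl⟩ : k = 0 ∧ l = 0 := by omega
    rcases hm.eq_or_lt with rfl | hm'
    · rw [octant_of_neg Δ P (m := 0 - 1) (by omega)]
      simp [octant, trinom, binom_zero_right]
    · have h1 := mul_octant_third Δ P 0 0 m
      have h2 : (m : ℝ) ≠ 0 := by exact_mod_cast hm'.ne'
      simp only [zero_add] at h1
      rw [mul_left_cancel₀ h2 h1, binom_of_lt _ m (by omega) (by omega)]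
      simp
  have hn : ((k + l + m : ℤ) : ℝ) ≠ 0 := by rw [Int.cast_ne_zero]; omega
  refine mul_left_cancel₀ hn ?_
  rw [mul_sub, mul_octant_third, ← sub_mul]
  lift k to ℕ using hk
  lift l to ℕ using hl
  lift m to ℕ using hm
  obtain ⟨q, hq⟩ : ∃ q, k + l = q + 1 := ⟨k + l - 1, by omega⟩
  have e1 : (k : ℤ) + l + m - 1 = ((q + m : ℕ) : ℤ) := by omega
  have e2 : (k : ℤ) + l = ((k + l : ℕ) : ℤ) := by omega
  have e3 : (l : ℤ) + m = ((l + m : ℕ) : ℤ) := by omega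
  rw [e1, e2, e3, binom_natCast, binom_natCast, octant_natCast, zpow_natCast, zpow_natCast,
    zpow_natCast, Nat.cast_add_choose, neg_pow, show q + m = m + q by ring, Nat.cast_add_choose,
    hq, show q + 1 + m = (m + q) + 1 by ring, Nat.factorial_succ, Nat.factorial_succ]
  have := k.factorial_ne_zero; have := l.factorial_ne_zero; have := m.factorial_ne_zero
  have := q.factorial_ne_zero
  push_cast
  field_simp
  ring

theorem quadrant_sub (Δ P : ℝ) (u v : ℤ) :
    quadrant Δ P u v - Δ * quadrant Δ P u (v - 1) = ∑ k ∈ Finset.Icc 0 (min u v),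
      (-1) ^ k * binom (u + v - 1 - k) (v - k) * binom u k * Δ ^ (u + v - 2 * k) * P ^ k := by
  rw [quadrant_eq_sum Δ P u v _ le_rfl, quadrant_eq_sum Δ P u (v - 1) (min u v) (by omega),
    Finset.mul_sum, ← Finset.sum_sub_distrib]
  refine Finset.sum_congr rfl fun k hk => ?_
  rw [Finset.mem_Icc] at hk
  rw [sub_right_comm v 1 k, octant_sub Δ P k _ _ hk.1 (by omega) (by omega)]
  rw [show k + (u - k) + (v - k) - 1 = u + v - 1 - k by ring, add_sub_cancel,
    show u - k + (v - k) = u + v - 2 * k by ring]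

theorem sum_Icc_zero_eq_add (f : ℤ → ℝ) {N : ℤ} (hN : 0 ≤ N) :
    ∑ k ∈ Finset.Icc 0 N, f k = ∑ k ∈ Finset.Icc 0 (N - 1), f k + f N := by
  have : Finset.Icc 0 N = insert N (Finset.Icc 0 (N - 1)) := by
    ext k; simp only [Finset.mem_Icc, Finset.mem_insert]; omega
  rw [this, Finset.sum_insert (by simp), add_comm]

theorem neg_one_zpow_eq {m n : ℤ} (h : Even (m - n)) : (-1 : ℝ) ^ m = (-1) ^ n := by
  rw [← sub_add_cancel m n, zpow_add₀ (by norm_num), h.neg_one_zpow, one_mul]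

end EightVertex

/-! ### The four formulas -/

theorem mainTheorem1 (a b c d : NNReal) (hpos : 0 < a + c) (hw : a + c = b + d)
    (p r Δ D P : ℝ) (hp : p = (a : ℝ) / (a + c)) (hr : r = (b : ℝ) / (b + d))
    (hΔ : Δ = 1 - (p + r)) (hD : D = r - p) (hP : P = (2 * p - 1) * (2 * r - 1))
    (C₈ : ℤ → ℕ → ℝ) (hC : ∀ i t, C₈ i t = edgeCorrelation (eightVertexLaw a b c d) 0 0 i t) :
    (∀ (i : ℤ) (t : ℕ), 0 < ProbabilityTheory.variance (state i t) (eightVertexLaw a b c d)) ∧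
    (∀ (i : ℤ) (t : ℕ), Odd (i + t) →
      C₈ i t = (-1) ^ (t + 1) * D * ∑ k ∈ Finset.Icc (0 : ℤ) (((t : ℤ) - 1 - |i|) / 2),
        (-1) ^ k * trinom (t - 1 - k) k ((t - 1 + i) / 2 - k) ((t - 1 - i) / 2 - k)
          * Δ ^ (t - 1 - 2 * k) * P ^ k) ∧
    (∀ t : ℕ, Even t →
      C₈ 0 t = ∑ k ∈ Finset.Icc (0 : ℤ) ((t : ℤ) / 2),
        (-1) ^ k * binom (t - 1 - k) (t / 2 - k) * binom (t / 2) k * Δ ^ (t - 2 * k) * P ^ k) ∧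
    (∀ (i : ℤ) (t : ℕ), Even (i + t) → i < 0 →
      C₈ i t = (∑ k ∈ Finset.Icc (0 : ℤ) (((t : ℤ) + i) / 2 - 1),
          (-1) ^ (t + k) * binom (t - 1 - k) ((t - i) / 2 - k) * binom ((t + i) / 2) k
            * Δ ^ (t - 2 * k) * P ^ k)
        + (-1) ^ (((t : ℤ) - i) / 2) * binom ((t - i) / 2 - 1) ((t + i) / 2 - 1)
            * Δ ^ (-i) * P ^ (((t : ℤ) + i) / 2)) ∧
    (∀ (i : ℤ) (t : ℕ), Even (i + t) → 0 < i →
      C₈ i t = (∑ k ∈ Finset.Icc (0 : ℤ) (((t : ℤ) - i) / 2 - 1),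
          (-1) ^ (t + k) * binom (t - 1 - k) ((t - i) / 2 - k) * binom ((t + i) / 2) k
            * Δ ^ (t - 2 * k) * P ^ k)
        + (-1) ^ (((t : ℤ) + i) / 2) * binom ((t + i) / 2) ((t - i) / 2)
            * Δ ^ i * P ^ (((t : ℤ) - i) / 2)) := by
  have hC' : ∀ i t, C₈ i t = spinCorr (ratio a c) (ratio b d) t i := fun i t =>
    (hC i t).trans (edgeCorrelation_eq_spinCorr _ _ i t)
  have hp' : ((ratio a c : unitInterval) : ℝ) = p := hp.symm
  have hr' : ((ratio b d : unitInterval) : ℝ) = r := hr.symm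
  have hF := spinCorr_eq (ratio a c) (ratio b d) Δ D P (by rw [hp', hr', hΔ])
    (by rw [hp', hr', hD]) (by rw [hp', hr', hP])
  -- A single formula for all even cases; the sign of `i` only decides which of `u`, `v` is the
  -- minimum.
  have hE : ∀ u v : ℤ, ∀ t : ℕ, u + v = t → C₈ (u - v) t =
      ∑ k ∈ Finset.Icc (0 : ℤ) (min u v), (-1) ^ (t + k) * binom (t - 1 - k) (v - k) * binom u k
        * Δ ^ (t - 2 * k) * P ^ k := by
    intro u v t h
    rw [hC', (hF t).2 u v h, quadrant_sub, Finset.mul_sum, h]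
    refine Finset.sum_congr rfl fun k _ => ?_
    rw [zpow_add₀ (by norm_num), zpow_natCast]
    ring
  have hv : ∀ i t, ProbabilityTheory.variance (state i t) (eightVertexLaw a b c d) = 4⁻¹ :=
    fun i t => variance_state (chainLaw (productLaw half) _ _) (integral_chainLaw_spin _ _) i t
  refine ⟨fun i t => by rw [hv]; norm_num, ?_, ?_, ?_, ?_⟩
  · intro i t hi
    obtain ⟨u, hu⟩ := hi
    obtain ⟨v, rfl⟩ : ∃ v, i = u - v := ⟨u - i, by ring⟩
    have e1 : ((t : ℤ) - 1 + (u - v)) / 2 = u := by omega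
    have e2 : ((t : ℤ) - 1 - (u - v)) / 2 = v := by omega
    have e3 : ((t : ℤ) - 1 - |u - v|) / 2 = min u v := by
      rcases abs_cases (u - v) with h | h <;> omega
    rw [hC', (hF t).1 u v (by omega), e1, e2, e3, quadrant_eq_sum Δ P u v _ le_rfl]
    congr 1
    refine Finset.sum_congr rfl fun k hk => ?_
    rw [Finset.mem_Icc] at hk
    rw [octant, if_pos (by omega), show k + (u - k) + (v - k) = t - 1 - k by omega,
      show u - k + (v - k) = t - 1 - 2 * k by omega, neg_eq_neg_one_mul P, mul_zpow]
    ring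
  · intro t ht
    obtain ⟨u, hu⟩ := ht
    have e1 : (t : ℤ) / 2 = u := by omega
    have h := hE u u t (by omega)
    rw [sub_self, min_self] at h
    rw [h, e1]
    refine Finset.sum_congr rfl fun k _ => ?_
    rw [neg_one_zpow_eq (m := t + k) (n := k) ⟨u, by omega⟩]
  · intro i t hi hneg
    obtain ⟨u, hu⟩ := hi
    obtain ⟨v, rfl⟩ : ∃ v, i = u - v := ⟨u - i, by ring⟩
    have e1 : ((t : ℤ) + (u - v)) / 2 = u := by omega
    have e2 : ((t : ℤ) - (u - v)) / 2 = v := by omega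
    rw [hE u v t (by omega), e1, e2, min_eq_left (by omega)]
    -- For `u < 0` the edge lies outside the light cone and both sides vanish. Otherwise the
    -- isolated term is `k = u`, where the second binomial is `1` and the first is reflected.
    rcases lt_or_ge u 0 with h0 | h0
    · rw [binom_of_neg _ (u - 1) (by omega), Finset.Icc_eq_empty (by omega),
        Finset.Icc_eq_empty (by omega)]
      simp
    · rw [sum_Icc_zero_eq_add _ h0, binom_self u h0, show (t : ℤ) - 1 - u = v - 1 by omega,
        show v - u = v - 1 - (u - 1) by ring, binom_symm (v - 1) (u - 1) (by omega),
        neg_one_zpow_eq (m := t + u) (n := v) ⟨u, by omega⟩,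
        show (t : ℤ) - 2 * u = -(u - v) by omega, mul_one]
  · intro i t hi hpos'
    obtain ⟨u, hu⟩ := hi
    obtain ⟨v, rfl⟩ : ∃ v, i = u - v := ⟨u - i, by ring⟩
    have e1 : ((t : ℤ) + (u - v)) / 2 = u := by omega
    have e2 : ((t : ℤ) - (u - v)) / 2 = v := by omega
    rw [hE u v t (by omega), e1, e2, min_eq_right (by omega)]
    -- Now the isolated term is `k = v`, where the first binomial has lower index `0`.
    rcases lt_or_ge v 0 with h0 | h0
    · rw [binom_of_neg _ v h0, Finset.Icc_eq_empty (by omega), Finset.Icc_eq_empty (by omega)]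
      simp
    · rw [sum_Icc_zero_eq_add _ h0, sub_self v, binom_zero_right, mul_one,
        neg_one_zpow_eq (m := t + v) (n := u) ⟨v, by omega⟩,
        show (t : ℤ) - 2 * v = u - v by omega]
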